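/- Let $n\ge 3$ be an integer, let $K\ge 1$ be real, let $\Omega\subset\mathbb R^n$ be a bounded domain (a nonempty, bounded, connected open set), and let $p\in\left(1,\frac{nK}{K+1}\right)$. A mapping $f\in W^{1,q}_{\mathrm{loc}}(\Omega;\mathbb R^n)$, $q\ge 1$, with distributional gradient $Df$ and Jacobian determinant $J_f=\det Df$, is called weakly $K$-quasiregular if either $J_f\ge 0$ a.e. in $\Omega$ or $J_f\le 0$ a.e. in $\Omega$, and $$\max_{|\xi|=1}|Df(x)\xi|\le K\min_{|\xi|=1}|Df(x)\xi|\qquad\text{for a.e. }x\in\Omega;$$ it is called $K$-quasiregular if in addition $f\in W^{1,n}_{\mathrm{loc}}(\Omega;\mathbb R^n)$, and quasiregular if it is $K'$-quasiregular for some $K'$. Then there is a weakly $K$-quasiregular mapping $$f\in W^{1,p}(\Omega;\mathbb R^n)\cap C(\Omega;\mathbb R^n)\cap L^\infty(\Omega;\mathbb R^n)$$ which is not quasiregular. -/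

import Mathlib

open MeasureTheory Metric Set
open scoped ContDiff ENNReal

/-- `G` is the distributional (weak) gradient of `f` on the open set `Ω ⊆ ℝⁿ`: both are locally
integrable on `Ω`, and `∫_Ω (∂_v φ) f = - ∫_Ω φ (G v)` for every direction `v` and every smooth
test function `φ` with compact support in `Ω`. Here `G x` is the `n × n` matrix `Df(x)`, viewed
as a linear map. -/
def HasWeakGradient {n : ℕ} (Ω : Set (EuclideanSpace ℝ (Fin n)))
    (f : EuclideanSpace ℝ (Fin n) → EuclideanSpace ℝ (Fin n))
    (G : EuclideanSpace ℝ (Fin n) → EuclideanSpace ℝ (Fin n) →L[ℝ] EuclideanSpace ℝ (Fin n)) :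
    Prop :=
  LocallyIntegrableOn f Ω volume ∧ LocallyIntegrableOn G Ω volume ∧
    ∀ φ : EuclideanSpace ℝ (Fin n) → ℝ, ContDiff ℝ ∞ φ → HasCompactSupport φ → tsupport φ ⊆ Ω →
      ∀ v : EuclideanSpace ℝ (Fin n),
        ∫ x in Ω, (fderiv ℝ φ x v) • f x = - ∫ x in Ω, φ x • G x v

/-- The Sobolev space `W^{1,p}(Ω; ℝⁿ)`: `f` and its weak gradient are in `L^p(Ω)`. -/
def MemW1p {n : ℕ} (p : ℝ≥0∞) (Ω : Set (EuclideanSpace ℝ (Fin n)))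
    (f : EuclideanSpace ℝ (Fin n) → EuclideanSpace ℝ (Fin n)) : Prop :=
  ∃ G, HasWeakGradient Ω f G ∧
    MemLp f p (volume.restrict Ω) ∧ MemLp G p (volume.restrict Ω)

/-- `f` belongs to `W^{1,p}_loc(Ω; ℝⁿ)`, and `J_f ≥ 0` a.e. in `Ω` or `J_f ≤ 0` a.e. in `Ω`, and
`max_{|ξ|=1} |Df(x) ξ| ≤ K min_{|η|=1} |Df(x) η|` for a.e. `x ∈ Ω`: that is, `f` is a weakly
`K`-quasiregular mapping of class `W^{1,p}_loc`. -/
def IsWeaklyQuasiregularMap {n : ℕ} (p : ℝ≥0∞) (K : ℝ) (Ω : Set (EuclideanSpace ℝ (Fin n)))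
    (f : EuclideanSpace ℝ (Fin n) → EuclideanSpace ℝ (Fin n)) : Prop :=
  ∃ G, HasWeakGradient Ω f G ∧
    (∀ C : Set (EuclideanSpace ℝ (Fin n)), IsCompact C → C ⊆ Ω →
      MemLp f p (volume.restrict C) ∧ MemLp G p (volume.restrict C)) ∧
    ((∀ᵐ x ∂volume.restrict Ω, 0 ≤ (G x).det) ∨ (∀ᵐ x ∂volume.restrict Ω, (G x).det ≤ 0)) ∧
    ∀ᵐ x ∂volume.restrict Ω, ∀ ξ ∈ sphere (0 : EuclideanSpace ℝ (Fin n)) 1,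
      ∀ η ∈ sphere (0 : EuclideanSpace ℝ (Fin n)) 1, ‖G x ξ‖ ≤ K * ‖G x η‖

/-- A `K`-quasiregular mapping on `Ω ⊆ ℝⁿ` is a weakly `K`-quasiregular mapping of class
`W^{1,n}_loc(Ω; ℝⁿ)`. -/
def IsQuasiregularMap {n : ℕ} (K : ℝ) (Ω : Set (EuclideanSpace ℝ (Fin n)))
    (f : EuclideanSpace ℝ (Fin n) → EuclideanSpace ℝ (Fin n)) : Prop :=
  IsWeaklyQuasiregularMap (n : ℝ≥0∞) K Ω f

open Filter Topology
open scoped NNReal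

/-! ### Radial stretchings -/

/-! Put `α = 1 + 1/K`. At `y ≠ 0`, with `u = y/‖y‖`, the radial stretching `y ↦ ‖y‖ ^ (-α) • y` has
differential `‖y‖ ^ (-α) (I - α u ⊗ u)`. Up to the scalar factor its singular values are `1` and `|1
- α| = 1/K`, and its determinant has the sign of `1 - α < 0`. So it satisfies the distortion
inequality with constant `K`, and its gradient is locally in `L^p` when `α p < n`, that is, `p <
nK/(K+1)`. It is, however, unbounded at the origin.

To keep the map bounded, the stretching is used only on a ring `ε r < ‖y‖ < r`, normalised to be the
identity on the outer sphere, and continued inside by `λ` times the identity, `λ = ε ^ (-α)`. This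
core has the wrong orientation, so it is filled up to a null set by tiny disjoint closed balls, the
linear map is replaced in each by a scaled copy of the same profile, and so on forever
(`exists_isCascade`). Almost every point ends up in exactly one ring (`ae_mem_shell`), where the
differential is a positive multiple of `I - α u ⊗ u` (`exists_cascadeDeriv_eq`).

On the rings of generation `k` the gradient has size about `λ ^ k`, and their total measure is about
`ε ^ (n k)`. Hence the integral of its `p`-th power behaves like the geometric series of ratio `λ ^
p ε ^ n = ε ^ (n - α p)`: convergent for `α p < n` (`memLp_cascadeDeriv`), divergent for `p = n`
because `α > 1` (`lintegral_cascadeDeriv_eq_top`). The radii do not affect these measures, so they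
may shrink fast enough for uniform convergence. The case `p = 1` of the estimate justifies termwise
integration by parts, and uniqueness of the weak gradient rules out any other gradient in `L^n_loc`.
-/

/-- The power `t ^ (-α)`, with `t` truncated to `[ε, 1]`. -/
noncomputable def clampPow (α ε t : ℝ) : ℝ := (max ε (min 1 t)) ^ (-α)

lemma clampPow_of_le {α ε t : ℝ} (hε1 : ε ≤ 1) (ht : t ≤ ε) : clampPow α ε t = ε ^ (-α) := by
  rw [clampPow, min_eq_right (ht.trans hε1), max_eq_left ht]

lemma clampPow_of_mem {α ε t : ℝ} (h1 : ε ≤ t) (h2 : t ≤ 1) : clampPow α ε t = t ^ (-α) := by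
  rw [clampPow, min_eq_right h2, max_eq_right h1]

lemma clampPow_of_one_le {α ε t : ℝ} (hε1 : ε ≤ 1) (ht : 1 ≤ t) : clampPow α ε t = 1 := by
  rw [clampPow, min_eq_left ht, max_eq_right hε1, Real.one_rpow]

lemma one_le_clampPow {α ε t : ℝ} (hα : 0 ≤ α) (hε : 0 < ε) (hε1 : ε ≤ 1) :
    1 ≤ clampPow α ε t :=
  Real.one_le_rpow_of_pos_of_le_one_of_nonpos (lt_max_of_lt_left hε)
    (max_le hε1 (min_le_left _ _)) (by linarith)

lemma clampPow_le {α ε t : ℝ} (hα : 0 ≤ α) (hε : 0 < ε) : clampPow α ε t ≤ ε ^ (-α) :=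
  Real.rpow_le_rpow_of_nonpos hε (le_max_left _ _) (by linarith)

lemma abs_clampPow_sub_one_le {α ε t : ℝ} (hα : 0 ≤ α) (hε : 0 < ε) (hε1 : ε ≤ 1) :
    |clampPow α ε t - 1| ≤ ε ^ (-α) := by
  rw [abs_of_nonneg (by linarith [one_le_clampPow (t := t) hα hε hε1])]
  linarith [clampPow_le (t := t) hα hε]

lemma exists_lipschitzWith_clampPow {α ε : ℝ} (hε : 0 < ε) (hε1 : ε ≤ 1) :
    ∃ C : ℝ≥0, LipschitzWith C (clampPow α ε) := by
  have h : ContDiffOn ℝ 1 (fun t : ℝ => t ^ (-α)) (Icc ε 1) := fun t ht =>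
    (Real.contDiffAt_rpow_const_of_ne (hε.trans_le ht.1).ne').contDiffWithinAt
  obtain ⟨C, hC⟩ := h.exists_lipschitzOnWith (by simp) (convex_Icc _ _) isCompact_Icc
  have hm : LipschitzWith 1 (fun t : ℝ => max ε (min 1 t)) :=
    (LipschitzWith.id.const_min 1).const_max ε
  refine ⟨C * 1, lipschitzOnWith_univ.1 ?_⟩
  exact hC.comp (lipschitzOnWith_univ.2 hm)
    fun t _ => ⟨le_max_left _ _, max_le hε1 (min_le_left _ _)⟩

section Radial

variable {E : Type*} [NormedAddCommGroup E] [InnerProductSpace ℝ E]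

/-- The difference of the radial stretching `y ↦ (‖y‖ / r) ^ (-α) • y` on the ring
`ε r ≤ ‖y‖ ≤ r`, extended linearly inside, and of the identity; it vanishes outside the ball of
radius `r`. -/
noncomputable def radialBump (α ε r : ℝ) (y : E) : E := (clampPow α ε (‖y‖ / r) - 1) • y

lemma radialBump_of_le_norm {α ε r : ℝ} (hε1 : ε ≤ 1) (hr : 0 < r) {y : E} (hy : r ≤ ‖y‖) :
    radialBump α ε r y = 0 := by
  rw [radialBump, clampPow_of_one_le hε1 ((one_le_div hr).2 hy), sub_self, zero_smul]

lemma norm_radialBump_le {α ε r : ℝ} (hα : 0 ≤ α) (hε : 0 < ε) (hε1 : ε ≤ 1) (hr : 0 < r)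
    (y : E) : ‖radialBump α ε r y‖ ≤ ε ^ (-α) * r := by
  have h0 : 0 ≤ ε ^ (-α) := Real.rpow_nonneg hε.le _
  rcases le_total r ‖y‖ with hy | hy
  · rw [radialBump_of_le_norm hε1 hr hy, norm_zero]
    positivity
  · rw [radialBump, norm_smul]
    exact mul_le_mul (abs_clampPow_sub_one_le hα hε hε1) hy (norm_nonneg _) h0

-- The bumps of different radii are rescalings of one another, so the Lipschitz constant does not
-- depend on `r`. Infinitely many balls can then be treated at once.
variable (E) in
lemma exists_lipschitzWith_radialBump {α ε : ℝ} (hα : 0 ≤ α) (hε : 0 < ε) (hε1 : ε ≤ 1) :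
    ∃ C : ℝ≥0, ∀ r : ℝ, 0 < r → LipschitzWith C (radialBump α ε r : E → E) := by
  obtain ⟨C, hC⟩ := exists_lipschitzWith_clampPow (α := α) hε hε1
  have h0 : 0 ≤ ε ^ (-α) := Real.rpow_nonneg hε.le _
  refine ⟨(ε ^ (-α)).toNNReal + C, fun r hr => LipschitzWith.of_dist_le_mul fun x y => ?_⟩
  wlog hxy : ‖y‖ ≤ ‖x‖ generalizing x y
  · rw [dist_comm, dist_comm x y]
    exact this y x (le_of_not_ge hxy)
  rcases le_total r ‖y‖ with hy | hy
  · rw [radialBump_of_le_norm hε1 hr hy, radialBump_of_le_norm hε1 hr (hy.trans hxy), dist_self]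
    positivity
  have hd : |clampPow α ε (‖x‖ / r) - clampPow α ε (‖y‖ / r)| ≤ C * (‖x - y‖ / r) := by
    have := hC.dist_le_mul (‖x‖ / r) (‖y‖ / r)
    rw [Real.dist_eq, Real.dist_eq] at this
    refine this.trans (mul_le_mul_of_nonneg_left ?_ C.2)
    rw [← sub_div, abs_div, abs_of_pos hr]
    exact div_le_div_of_nonneg_right (abs_norm_sub_norm_le x y) hr.le
  -- The increment of the scalar factor multiplies the shorter vector `y`, whose norm is at most
  -- `r`; this cancels the `1 / r` in the previous bound.
  have e : radialBump α ε r x - radialBump α ε r y = (clampPow α ε (‖x‖ / r) - 1) • (x - y) +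
      (clampPow α ε (‖x‖ / r) - clampPow α ε (‖y‖ / r)) • y := by
    simp only [radialBump]; module
  rw [dist_eq_norm, dist_eq_norm, e]
  refine (norm_add_le _ _).trans ?_
  rw [norm_smul, norm_smul, NNReal.coe_add, Real.coe_toNNReal _ h0, add_mul]
  refine add_le_add (mul_le_mul_of_nonneg_right (abs_clampPow_sub_one_le hα hε hε1)
    (norm_nonneg _)) ?_
  calc _ ≤ C * (‖x - y‖ / r) * r := mul_le_mul hd hy (norm_nonneg _) (by positivity)
    _ = _ := by field_simp

/-- The linear map `ξ ↦ ξ - α ⟪u, ξ⟫ u`. -/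
noncomputable def radialDeriv (α : ℝ) (u : E) : E →L[ℝ] E :=
  ContinuousLinearMap.id ℝ E - α • (innerSL ℝ u).smulRight u

lemma radialDeriv_apply (α : ℝ) (u ξ : E) :
    radialDeriv α u ξ = ξ - (α * inner ℝ u ξ) • u := by
  simp [radialDeriv, smul_smul]

/-- The map fixes the orthogonal complement of `u` and multiplies `u` by `1 - α`. For `0 ≤ α ≤ 2`
the correction term is nonpositive, which yields the two bounds below. -/
lemma norm_radialDeriv_apply_sq {α : ℝ} {u : E} (hu : ‖u‖ = 1) (ξ : E) :
    ‖radialDeriv α u ξ‖ ^ 2 = ‖ξ‖ ^ 2 - α * (2 - α) * inner ℝ u ξ ^ 2 := by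
  rw [radialDeriv_apply, norm_sub_sq_real, norm_smul, hu, inner_smul_right, real_inner_comm,
    mul_one, Real.norm_eq_abs, sq_abs]
  ring

lemma norm_radialDeriv_apply_le {α : ℝ} (h0 : 0 ≤ α) (h2 : α ≤ 2) {u : E} (hu : ‖u‖ = 1) (ξ : E) :
    ‖radialDeriv α u ξ‖ ≤ ‖ξ‖ := by
  refine le_of_sq_le_sq ?_ (norm_nonneg _)
  rw [norm_radialDeriv_apply_sq hu]
  have : 0 ≤ α * (2 - α) * inner ℝ u ξ ^ 2 :=
    mul_nonneg (mul_nonneg h0 (by linarith)) (sq_nonneg _)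
  linarith

lemma le_norm_radialDeriv_apply {α : ℝ} (h0 : 0 ≤ α) (h2 : α ≤ 2) {u : E} (hu : ‖u‖ = 1) (ξ : E) :
    |1 - α| * ‖ξ‖ ≤ ‖radialDeriv α u ξ‖ := by
  refine le_of_sq_le_sq ?_ (norm_nonneg _)
  rw [norm_radialDeriv_apply_sq hu, mul_pow, sq_abs]
  have h1 : inner ℝ u ξ ^ 2 ≤ ‖ξ‖ ^ 2 := by
    have := abs_real_inner_le_norm u ξ
    rw [hu, one_mul] at this
    exact sq_le_sq' (by linarith [neg_abs_le (inner ℝ u ξ)]) ((le_abs_self _).trans this)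
  have : 0 ≤ α * (2 - α) * (‖ξ‖ ^ 2 - inner ℝ u ξ ^ 2) :=
    mul_nonneg (mul_nonneg h0 (by linarith)) (by linarith)
  linarith

lemma det_radialDeriv [FiniteDimensional ℝ E] {α : ℝ} {u : E} (hu : ‖u‖ = 1) :
    (radialDeriv α u).det = 1 - α := by
  have : (radialDeriv α u : E →ₗ[ℝ] E) =
      LinearMap.transvection (innerSL ℝ u : E →ₗ[ℝ] ℝ) (-α • u) := by
    ext ξ
    simp [radialDeriv_apply, LinearMap.transvection.apply, smul_smul, sub_eq_add_neg, mul_comm]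
  rw [ContinuousLinearMap.det, this, LinearMap.transvection.det]
  simp [inner_smul_right, hu, sub_eq_add_neg]

lemma hasFDerivAt_radialBump_of_norm_lt {α ε r : ℝ} (hε1 : ε ≤ 1) (hr : 0 < r) {y : E}
    (hy : ‖y‖ < ε * r) :
    HasFDerivAt (radialBump α ε r) ((ε ^ (-α) - 1) • ContinuousLinearMap.id ℝ E) y := by
  refine ((hasFDerivAt_id y).const_smul (ε ^ (-α) - 1)).congr_of_eventuallyEq ?_
  filter_upwards [continuous_norm.continuousAt.eventually_lt_const hy] with z hz
  rw [radialBump, clampPow_of_le hε1 ((div_le_iff₀ hr).2 hz.le)]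
  rfl

lemma hasFDerivAt_norm_div_rpow_smul {α r : ℝ} (hr : 0 < r) {y : E} (hy : y ≠ 0) :
    HasFDerivAt (fun z : E => (‖z‖ / r) ^ (-α) • z)
      ((‖y‖ / r) ^ (-α) • radialDeriv α (‖y‖⁻¹ • y)) y := by
  have hn : 0 < ‖y‖ := norm_pos_iff.2 hy
  -- The squared norm has a simple derivative, so the radial factor is rewritten as its power with
  -- exponent `-α / 2`.
  have h1 : HasFDerivAt (fun z : E => ‖z‖ ^ 2) (2 • innerSL ℝ y) y :=
    (hasStrictFDerivAt_norm_sq y).hasFDerivAt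
  have h2 : HasFDerivAt (fun z : E => (‖z‖ ^ 2 * (r ^ 2)⁻¹) ^ (-α / 2)) _ y :=
    (h1.mul_const (r ^ 2)⁻¹).rpow_const (p := -α / 2) (Or.inl (by positivity))
  have h3 := h2.smul (hasFDerivAt_id y)
  have e : ∀ z : E, (‖z‖ / r) ^ (-α) = (‖z‖ ^ 2 * (r ^ 2)⁻¹) ^ (-α / 2) := fun z => by
    rw [← div_eq_mul_inv, ← div_pow, ← Real.rpow_natCast, ← Real.rpow_mul (by positivity)]
    congr 1
    push_cast
    ring
  have e' : (‖y‖ ^ 2 * (r ^ 2)⁻¹) ^ (-α / 2 - 1) = (‖y‖ / r) ^ (-α) * (r ^ 2 / ‖y‖ ^ 2) := by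
    rw [Real.rpow_sub_one (by positivity), e, div_eq_mul_inv, mul_inv, inv_inv, div_eq_inv_mul (r ^ 2)]
  simp only [e]
  refine h3.congr_fderiv ?_
  ext1 ξ
  simp only [id_eq, add_apply, smul_apply,
    ContinuousLinearMap.id_apply, ContinuousLinearMap.smulRight_apply, radialDeriv_apply,
    inner_smul_left, ← e, e', innerSL_apply_apply]
  simp only [smul_eq_mul, nsmul_eq_mul, smul_smul, RCLike.conj_to_real, Nat.cast_ofNat,
    sub_eq_add_neg, ← neg_smul]
  rw [smul_add, smul_smul]
  congr 2
  field_simp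

lemma hasFDerivAt_radialBump_of_mem {α ε r : ℝ} (hε : 0 < ε) (hr : 0 < r) {y : E}
    (h1 : ε * r < ‖y‖) (h2 : ‖y‖ < r) :
    HasFDerivAt (radialBump α ε r)
      ((‖y‖ / r) ^ (-α) • radialDeriv α (‖y‖⁻¹ • y) - ContinuousLinearMap.id ℝ E) y := by
  have hy : y ≠ 0 := norm_pos_iff.1 ((mul_pos hε hr).trans h1)
  refine ((hasFDerivAt_norm_div_rpow_smul hr hy).sub (hasFDerivAt_id y)).congr_of_eventuallyEq ?_
  filter_upwards [continuous_norm.continuousAt.eventually_lt_const h2,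
    continuous_norm.continuousAt.eventually_const_lt h1] with z hz hz'
  rw [radialBump, clampPow_of_mem ((le_div_iff₀ hr).2 hz'.le) ((div_le_one hr).2 hz.le), sub_smul,
    one_smul]
  rfl

end Radial

/-! ### Families of disjoint balls -/

/-- A countable family of pairwise disjoint closed balls, indexed by their centers. -/
structure BallFamily (E : Type*) [NormedAddCommGroup E] where
  /-- The set of centers. -/
  centers : Set E
  /-- The radius of the ball with a given center. -/
  radius : E → ℝ
  countable : centers.Countable
  radius_pos : ∀ c ∈ centers, 0 < radius c
  pairwiseDisjoint : centers.PairwiseDisjoint fun c => closedBall c (radius c)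

namespace BallFamily

section Sets

variable {E : Type*} [NormedAddCommGroup E]

/-- The union of the closed balls. -/
def body (F : BallFamily E) : Set E := ⋃ c ∈ F.centers, closedBall c (F.radius c)

/-- The union of the open concentric balls, shrunk by the factor `ε`. -/
def core (ε : ℝ) (F : BallFamily E) : Set E := ⋃ c ∈ F.centers, ball c (ε * F.radius c)

/-- The union of the open rings between the balls of the core and those of the body. -/
def shell (ε : ℝ) (F : BallFamily E) : Set E :=
  ⋃ c ∈ F.centers, ball c (F.radius c) \ closedBall c (ε * F.radius c)

/-- The family that consists of a single ball. -/
def single (a : E) (R : ℝ) (hR : 0 < R) : BallFamily E where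
  centers := {a}
  radius _ := R
  countable := countable_singleton a
  radius_pos _ _ := hR
  pairwiseDisjoint := pairwiseDisjoint_singleton _ _

lemma body_single (a : E) {R : ℝ} (hR : 0 < R) : (single a R hR).body = closedBall a R := by
  simp [body, single]

lemma core_single (ε : ℝ) (a : E) {R : ℝ} (hR : 0 < R) :
    (single a R hR).core ε = ball a (ε * R) := by
  simp [core, single]

variable (F : BallFamily E)

lemma isOpen_core (ε : ℝ) : IsOpen (F.core ε) := isOpen_biUnion fun _ _ => isOpen_ball

lemma isOpen_shell (ε : ℝ) : IsOpen (F.shell ε) :=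
  isOpen_biUnion fun _ _ => isOpen_ball.sdiff isClosed_closedBall

lemma core_subset_body {ε : ℝ} (hε1 : ε ≤ 1) : F.core ε ⊆ F.body :=
  iUnion₂_mono fun c hc => (ball_subset_ball
    (mul_le_of_le_one_left (F.radius_pos c hc).le hε1)).trans ball_subset_closedBall

lemma shell_subset_body (ε : ℝ) : F.shell ε ⊆ F.body :=
  iUnion₂_mono fun _ _ => sdiff_subset.trans ball_subset_closedBall

variable {F} in
lemma center_unique {c c' x : E} (hc : c ∈ F.centers) (hc' : c' ∈ F.centers)
    (hx : x ∈ closedBall c (F.radius c)) (hx' : x ∈ closedBall c' (F.radius c')) : c = c' :=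
  F.pairwiseDisjoint.elim_set hc hc' x hx hx'

lemma disjoint_core_shell {ε : ℝ} (hε1 : ε ≤ 1) : Disjoint (F.core ε) (F.shell ε) := by
  refine Set.disjoint_left.2 fun x hx hx' => ?_
  simp only [core, shell, mem_iUnion] at hx hx'
  obtain ⟨c, hc, hx⟩ := hx
  obtain ⟨c', hc', hx'⟩ := hx'
  obtain rfl := center_unique hc hc' (ball_subset_closedBall (ball_subset_ball
    (mul_le_of_le_one_left (F.radius_pos c hc).le hε1) hx)) (ball_subset_closedBall hx'.1)
  exact hx'.2 (ball_subset_closedBall hx)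

variable [MeasurableSpace E] [BorelSpace E]

lemma measurableSet_body : MeasurableSet F.body :=
  .biUnion F.countable fun _ _ => measurableSet_closedBall

variable [NormedSpace ℝ E] [FiniteDimensional ℝ E] (μ : Measure E) [μ.IsAddHaarMeasure]

lemma measure_core {ε : ℝ} (hε : 0 < ε) (hε1 : ε ≤ 1) :
    μ (F.core ε) = ENNReal.ofReal (ε ^ Module.finrank ℝ E) * μ F.body := by
  have hd : F.centers.PairwiseDisjoint fun c => ball c (ε * F.radius c) :=
    F.pairwiseDisjoint.mono_on fun c hc => (ball_subset_ball
      (mul_le_of_le_one_left (F.radius_pos c hc).le hε1)).trans ball_subset_closedBall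
  rw [core, body, measure_biUnion F.countable hd fun _ _ => measurableSet_ball,
    measure_biUnion F.countable F.pairwiseDisjoint fun _ _ => measurableSet_closedBall,
    ← ENNReal.tsum_mul_left]
  refine tsum_congr fun c => ?_
  rw [Measure.addHaar_ball_mul_of_pos μ _ hε, Measure.addHaar_closedBall μ _
    (F.radius_pos c c.2).le, Measure.addHaar_ball_of_pos μ _ (F.radius_pos c c.2)]

lemma measure_body_diff {ε : ℝ} (hε : 0 < ε) :
    μ (F.body \ (F.core ε ∪ F.shell ε)) = 0 := by
  have hs : F.body \ (F.core ε ∪ F.shell ε) ⊆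
      ⋃ c ∈ F.centers, sphere c (F.radius c) ∪ sphere c (ε * F.radius c) := by
    intro x ⟨hx, hx'⟩
    simp only [body, core, shell, mem_iUnion, mem_union, not_or, not_exists, mem_ball,
      mem_closedBall, mem_sphere] at hx hx' ⊢
    obtain ⟨c, hc, hx⟩ := hx
    refine ⟨c, hc, ?_⟩
    rcases hx.lt_or_eq with h | h
    · exact Or.inr (le_antisymm (not_lt.1 fun h' => hx'.2 c hc ⟨h, h'.not_ge⟩) (not_lt.1 (hx'.1 c hc)))
    · exact Or.inl h
  refine measure_mono_null hs ((measure_biUnion_null_iff F.countable).2 fun c hc => ?_)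
  have := F.radius_pos c hc
  exact measure_union_null (Measure.addHaar_sphere_of_ne_zero μ _ this.ne')
    (Measure.addHaar_sphere_of_ne_zero μ _ (mul_pos hε this).ne')

lemma measure_body_le {ε : ℝ} (hε : 0 < ε) : μ F.body ≤ μ (F.core ε) + μ (F.shell ε) :=
  calc μ F.body ≤ μ (F.body ∩ (F.core ε ∪ F.shell ε)) + μ (F.body \ (F.core ε ∪ F.shell ε)) :=
        measure_le_inter_add_sdiff _ _ _
    _ ≤ _ := by
      rw [F.measure_body_diff μ hε, add_zero]
      exact (measure_mono inter_subset_right).trans (measure_union_le _ _)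

/-- An open set is covered almost everywhere by a family of small disjoint closed balls. -/
lemma exists_ae_cover {U : Set E} (hU : IsOpen U) {δ : ℝ} (hδ : 0 < δ) :
    ∃ F : BallFamily E, (∀ c ∈ F.centers, F.radius c ≤ δ) ∧ F.body ⊆ U ∧ μ (U \ F.body) = 0 := by
  -- Every point of `U` admits arbitrarily small radii whose closed ball stays in `U`, so the
  -- Besicovitch covering theorem applies.
  obtain ⟨t, r, htc, -, htr, hμ, hd⟩ := Besicovitch.exists_disjoint_closedBall_covering_ae μ
    (fun x => {r | closedBall x r ⊆ U}) U (fun x hx η hη => by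
      obtain ⟨ρ, hρ, hρU⟩ := nhds_basis_closedBall.mem_iff.1 (hU.mem_nhds hx)
      exact ⟨min ρ (η / 2), (closedBall_subset_closedBall (min_le_left _ _)).trans hρU,
        lt_min hρ (half_pos hη), (min_le_right _ _).trans_lt (half_lt_self hη)⟩)
    (fun _ => δ) fun _ _ => hδ
  exact ⟨⟨t, r, htc, fun c hc => (htr c hc).2.1, hd⟩, fun c hc => (htr c hc).2.2.le,
    iUnion₂_subset fun c hc => (htr c hc).1, hμ⟩

end Sets

/-! ### Superposition of the bumps of one family -/

section Bumps

variable {E : Type*} [NormedAddCommGroup E] [InnerProductSpace ℝ E]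

open Classical in
/-- The sum of the radial bumps supported by the balls of the family. -/
noncomputable def bumps (α ε : ℝ) (F : BallFamily E) (x : E) : E :=
  if h : ∃ c ∈ F.centers, x ∈ closedBall c (F.radius c) then
    radialBump α ε (F.radius h.choose) (x - h.choose) else 0

variable {F : BallFamily E} {α ε : ℝ}

lemma bumps_of_mem {c x : E} (hc : c ∈ F.centers) (hx : x ∈ closedBall c (F.radius c)) :
    F.bumps α ε x = radialBump α ε (F.radius c) (x - c) := by
  have h : ∃ c ∈ F.centers, x ∈ closedBall c (F.radius c) := ⟨c, hc, hx⟩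
  rw [bumps, dif_pos h, center_unique h.choose_spec.1 hc h.choose_spec.2 hx]

lemma bumps_of_notMem {x : E} (hx : x ∉ F.body) : F.bumps α ε x = 0 := by
  rw [bumps, dif_neg]
  simpa [body] using hx

lemma norm_bumps_le (hα : 0 ≤ α) (hε : 0 < ε) (hε1 : ε ≤ 1) {δ : ℝ} (hδ0 : 0 ≤ δ)
    (hδ : ∀ c ∈ F.centers, F.radius c ≤ δ) (x : E) : ‖F.bumps α ε x‖ ≤ ε ^ (-α) * δ := by
  have h0 : 0 ≤ ε ^ (-α) := Real.rpow_nonneg hε.le _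
  by_cases hx : x ∈ F.body
  · simp only [body, mem_iUnion] at hx
    obtain ⟨c, hc, hx⟩ := hx
    rw [bumps_of_mem hc hx]
    exact (norm_radialBump_le hα hε hε1 (F.radius_pos c hc) _).trans
      (mul_le_mul_of_nonneg_left (hδ c hc) h0)
  · rw [bumps_of_notMem hx, norm_zero]
    positivity

-- Each bump vanishes outside its ball. For points that share no ball, each value is therefore
-- controlled separately by the distance, whence the factor 2; the constant is the same for all
-- families.
variable (E) in
lemma exists_lipschitzWith_bumps (hα : 0 ≤ α) (hε : 0 < ε) (hε1 : ε ≤ 1) :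
    ∃ C : ℝ≥0, ∀ F : BallFamily E, LipschitzWith C (F.bumps α ε) := by
  obtain ⟨C, hC⟩ := exists_lipschitzWith_radialBump E hα hε hε1
  refine ⟨2 * C, fun F => LipschitzWith.of_dist_le_mul ?_⟩
  have hin : ∀ c ∈ F.centers, ∀ x ∈ closedBall c (F.radius c), ∀ y ∈ closedBall c (F.radius c),
      ‖F.bumps α ε x - F.bumps α ε y‖ ≤ C * dist x y := fun c hc x hx y hy => by
    rw [bumps_of_mem hc hx, bumps_of_mem hc hy, ← dist_eq_norm]
    simpa using (hC _ (F.radius_pos c hc)).dist_le_mul (x - c) (y - c)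
  have hout : ∀ c ∈ F.centers, ∀ x ∈ closedBall c (F.radius c), ∀ y ∉ closedBall c (F.radius c),
      ‖F.bumps α ε x‖ ≤ C * dist x y := fun c hc x hx y hy => by
    have := (hC _ (F.radius_pos c hc)).dist_le_mul (x - c) (y - c)
    rw [radialBump_of_le_norm hε1 (F.radius_pos c hc) (y := y - c)
      (by rw [← dist_eq_norm]; exact (not_le.1 hy).le)] at this
    rw [bumps_of_mem hc hx]
    simpa using this
  have hbd : ∀ x y, (∃ c ∈ F.centers, x ∈ closedBall c (F.radius c) ∧
      y ∈ closedBall c (F.radius c)) ∨ ‖F.bumps α ε x‖ ≤ C * dist x y := fun x y => by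
    by_cases hx : x ∈ F.body
    · simp only [body, mem_iUnion] at hx
      obtain ⟨c, hc, hx⟩ := hx
      by_cases hy : y ∈ closedBall c (F.radius c)
      · exact Or.inl ⟨c, hc, hx, hy⟩
      · exact Or.inr (hout c hc x hx y hy)
    · rw [bumps_of_notMem hx, norm_zero]
      exact Or.inr (by positivity)
  intro x y
  have h0 : (0 : ℝ) ≤ C * dist x y := by positivity
  rw [dist_eq_norm (F.bumps α ε x), NNReal.coe_mul, NNReal.coe_ofNat, mul_assoc, two_mul]
  rcases hbd x y with ⟨c, hc, hx, hy⟩ | h1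
  · exact (hin c hc x hx y hy).trans (by linarith)
  rcases hbd y x with ⟨c, hc, hy, hx⟩ | h2
  · exact (hin c hc x hx y hy).trans (by linarith)
  rw [dist_comm y x] at h2
  exact (norm_sub_le _ _).trans (add_le_add h1 h2)

lemma bumps_eventuallyEq {c x : E} (hc : c ∈ F.centers) (hx : x ∈ ball c (F.radius c)) :
    F.bumps α ε =ᶠ[𝓝 x] fun y => radialBump α ε (F.radius c) (y - c) := by
  filter_upwards [isOpen_ball.mem_nhds hx] with y hy
  exact bumps_of_mem hc (ball_subset_closedBall hy)

lemma fderiv_bumps_of_mem_core (hε1 : ε ≤ 1) {x : E} (hx : x ∈ F.core ε) :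
    fderiv ℝ (F.bumps α ε) x = (ε ^ (-α) - 1) • ContinuousLinearMap.id ℝ E := by
  simp only [core, mem_iUnion] at hx
  obtain ⟨c, hc, hx⟩ := hx
  have hr := F.radius_pos c hc
  have hxr := ball_subset_ball (mul_le_of_le_one_left hr.le hε1) hx
  rw [(bumps_eventuallyEq hc hxr).fderiv_eq, fderiv_comp_sub (f := radialBump α ε (F.radius c))]
  exact (hasFDerivAt_radialBump_of_norm_lt hε1 hr (by rwa [← dist_eq_norm])).fderiv

lemma exists_fderiv_bumps_of_mem_shell (hε : 0 < ε) {x : E} (hx : x ∈ F.shell ε) :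
    ∃ t ∈ Ioo ε 1, ∃ u : E, ‖u‖ = 1 ∧ fderiv ℝ (F.bumps α ε) x =
      t ^ (-α) • radialDeriv α u - ContinuousLinearMap.id ℝ E := by
  simp only [shell, mem_iUnion] at hx
  obtain ⟨c, hc, hxr, hxε⟩ := hx
  have hr := F.radius_pos c hc
  rw [(bumps_eventuallyEq hc hxr).fderiv_eq, fderiv_comp_sub (f := radialBump α ε (F.radius c))]
  rw [mem_ball, dist_eq_norm] at hxr
  rw [mem_closedBall, dist_eq_norm, not_le] at hxε
  have hn : 0 < ‖x - c‖ := (mul_pos hε hr).trans hxε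
  refine ⟨‖x - c‖ / F.radius c, ⟨(lt_div_iff₀ hr).2 hxε, (div_lt_one hr).2 hxr⟩,
    ‖x - c‖⁻¹ • (x - c), by rw [norm_smul, norm_inv, norm_norm, inv_mul_cancel₀ hn.ne'], ?_⟩
  exact (hasFDerivAt_radialBump_of_mem hε hr hxε hxr).fderiv

lemma fderiv_bumps_of_disjoint {V : Set E} (hV : IsOpen V) (hVF : Disjoint V F.body) {x : E}
    (hx : x ∈ V) : fderiv ℝ (F.bumps α ε) x = 0 := by
  have : F.bumps α ε =ᶠ[𝓝 x] fun _ => 0 := by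
    filter_upwards [hV.mem_nhds hx] with y hy
    exact bumps_of_notMem (Set.disjoint_left.1 hVF hy)
  rw [this.fderiv_eq, fderiv_fun_const]
  rfl

end Bumps

end BallFamily

/-! ### Cascades of ball families -/

section Cascade

variable {E : Type*} [NormedAddCommGroup E] [MeasurableSpace E]

/-- A sequence of families of disjoint balls, each of which covers almost all of the core of the
preceding one. -/
structure IsCascade (μ : Measure E) (ε : ℝ) (δ : ℕ → ℝ) (F : ℕ → BallFamily E) : Prop where
  radius_le : ∀ k, ∀ c ∈ (F k).centers, (F k).radius c ≤ δ k
  body_subset : ∀ k, (F (k + 1)).body ⊆ (F k).core ε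
  measure_diff : ∀ k, μ ((F k).core ε \ (F (k + 1)).body) = 0

lemma exists_isCascade [BorelSpace E] [NormedSpace ℝ E] [FiniteDimensional ℝ E] (μ : Measure E)
    [μ.IsAddHaarMeasure] (ε : ℝ) {δ : ℕ → ℝ} (hδ : ∀ k, 0 < δ k) (a : E) {R : ℝ} (hR : 0 < R)
    (hRδ : R ≤ δ 0) :
    ∃ F : ℕ → BallFamily E, IsCascade μ ε δ F ∧ F 0 = BallFamily.single a R hR := by
  have h : ∀ (k : ℕ) (F : BallFamily E), ∃ F' : BallFamily E,
      (∀ c ∈ F'.centers, F'.radius c ≤ δ (k + 1)) ∧ F'.body ⊆ F.core ε ∧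
        μ (F.core ε \ F'.body) = 0 := fun k F =>
    BallFamily.exists_ae_cover μ (F.isOpen_core ε) (hδ (k + 1))
  choose next h1 h2 h3 using h
  let F : ℕ → BallFamily E := fun k => Nat.rec (BallFamily.single a R hR) next k
  have hF : ∀ k, F (k + 1) = next k (F k) := fun _ => rfl
  refine ⟨F, ⟨fun k => ?_, fun k => ?_, fun k => ?_⟩, rfl⟩
  · cases k with
    | zero => exact fun _ _ => hRδ
    | succ k => rw [hF]; exact h1 k _
  · rw [hF]; exact h2 k _
  · rw [hF]; exact h3 k _

namespace IsCascade

variable {μ : Measure E} {ε : ℝ} {δ : ℕ → ℝ} {F : ℕ → BallFamily E}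

lemma body_subset_core (h : IsCascade μ ε δ F) (hε1 : ε ≤ 1) {m k : ℕ} (hmk : m < k) :
    (F k).body ⊆ (F m).core ε := by
  induction k, hmk using Nat.le_induction with
  | base => exact h.body_subset m
  | succ k _ ih => exact (h.body_subset k).trans (((F k).core_subset_body hε1).trans ih)

lemma disjoint_shell_body (h : IsCascade μ ε δ F) (hε1 : ε ≤ 1) {m k : ℕ} (hmk : m < k) :
    Disjoint ((F m).shell ε) (F k).body :=
  (((F m).disjoint_core_shell hε1).mono_left (h.body_subset_core hε1 hmk)).symm

lemma pairwise_disjoint_shell (h : IsCascade μ ε δ F) (hε1 : ε ≤ 1) :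
    Pairwise (Function.onFun Disjoint fun k => (F k).shell ε) := fun m k hmk => by
  rcases hmk.lt_or_gt with hlt | hlt
  · exact (h.disjoint_shell_body hε1 hlt).mono_right ((F k).shell_subset_body ε)
  · exact ((h.disjoint_shell_body hε1 hlt).mono_right ((F m).shell_subset_body ε)).symm

variable [BorelSpace E] [NormedSpace ℝ E] [FiniteDimensional ℝ E] [μ.IsAddHaarMeasure]

/-- Shrinking the balls multiplies the measure by `ε ^ n`, and the next family refills the core up
to a null set. The radii chosen for that family play no role. -/
lemma measure_body (h : IsCascade μ ε δ F) (hε : 0 < ε) (hε1 : ε ≤ 1) (k : ℕ) :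
    μ (F k).body = ENNReal.ofReal (ε ^ Module.finrank ℝ E) ^ k * μ (F 0).body := by
  induction k with
  | zero => simp
  | succ k ih =>
    have e : μ (F (k + 1)).body = μ ((F k).core ε) :=
      measure_eq_measure_of_null_sdiff (h.body_subset k) (h.measure_diff k)
    rw [e, BallFamily.measure_core _ μ hε hε1, ih, pow_succ']
    ring

/-- Outside the null sets of bounding spheres and covering defects, a point that avoids every shell
stays in every body, and the measures of the bodies tend to zero. -/
lemma ae_mem_shell [Nontrivial E] (h : IsCascade μ ε δ F) (hε : 0 < ε) (hε1 : ε < 1)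
    (hfin : μ (F 0).body ≠ ⊤) : ∀ᵐ x ∂μ, x ∈ (F 0).body → ∃ k, x ∈ (F k).shell ε := by
  have hq : ENNReal.ofReal (ε ^ Module.finrank ℝ E) < 1 := by
    rw [← ENNReal.ofReal_one]
    exact (ENNReal.ofReal_lt_ofReal_iff one_pos).2
      (pow_lt_one₀ hε.le hε1 Module.finrank_pos.ne')
  have hinter : μ (⋂ k, (F k).body) = 0 := by
    have ht := ENNReal.Tendsto.mul_const (b := μ (F 0).body)
      (ENNReal.tendsto_pow_atTop_nhds_zero_of_lt_one hq) (Or.inr hfin)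
    rw [zero_mul] at ht
    exact nonpos_iff_eq_zero.1 (ge_of_tendsto' ht fun k =>
      (measure_mono (iInter_subset _ k)).trans (h.measure_body hε hε1.le k).le)
  have h1 : ∀ᵐ x ∂μ, ∀ k, x ∉ (F k).core ε \ (F (k + 1)).body :=
    ae_all_iff.2 fun k => measure_eq_zero_iff_ae_notMem.1 (h.measure_diff k)
  have h2 : ∀ᵐ x ∂μ, ∀ k, x ∉ (F k).body \ ((F k).core ε ∪ (F k).shell ε) :=
    ae_all_iff.2 fun k => measure_eq_zero_iff_ae_notMem.1 ((F k).measure_body_diff μ hε)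
  filter_upwards [h1, h2, measure_eq_zero_iff_ae_notMem.1 hinter] with x hx1 hx2 hx3 hx0
  by_contra! hs
  refine hx3 (mem_iInter.2 fun k => ?_)
  induction k with
  | zero => exact hx0
  | succ k ih =>
    by_contra hk
    exact hx2 k ⟨ih, fun hc => hc.elim (fun hc => hx1 k ⟨hc, hk⟩) (hs k)⟩

lemma measure_shell_ge (h : IsCascade μ ε δ F) (hε : 0 < ε) (hε1 : ε ≤ 1)
    (hfin : μ (F 0).body ≠ ⊤) (k : ℕ) :
    ENNReal.ofReal (1 - ε ^ Module.finrank ℝ E) *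
      (ENNReal.ofReal (ε ^ Module.finrank ℝ E) ^ k * μ (F 0).body) ≤ μ ((F k).shell ε) := by
  have hb := h.measure_body hε hε1 k
  have hk : μ (F k).body ≠ ⊤ := by
    rw [hb]
    exact ENNReal.mul_ne_top (ENNReal.pow_ne_top ENNReal.ofReal_ne_top) hfin
  have h1 := (F k).measure_body_le μ hε
  rw [(F k).measure_core μ hε hε1] at h1
  rw [← hb, ENNReal.ofReal_sub _ (by positivity), ENNReal.ofReal_one,
    ENNReal.sub_mul fun _ _ => hk, one_mul]
  exact tsub_le_iff_left.2 h1

end IsCascade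

end Cascade

/-! ### The limit map and its weak gradient -/

section CascadeMap

variable {E : Type*} [NormedAddCommGroup E] [InnerProductSpace ℝ E]

/-- The limit map of a cascade: every ball of every family contributes a radial bump. -/
noncomputable def cascadeMap (α ε : ℝ) (F : ℕ → BallFamily E) (x : E) : E :=
  x + ∑' k, (ε ^ (-α)) ^ k • (F k).bumps α ε x

/-- The termwise derivative of `cascadeMap`. -/
noncomputable def cascadeDeriv (α ε : ℝ) (F : ℕ → BallFamily E) (x : E) : E →L[ℝ] E :=
  ContinuousLinearMap.id ℝ E + ∑' k, (ε ^ (-α)) ^ k • fderiv ℝ ((F k).bumps α ε) x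

variable [MeasurableSpace E] {μ : Measure E} {α ε : ℝ} {δ : ℕ → ℝ} {F : ℕ → BallFamily E}

namespace IsCascade

lemma norm_smul_bumps_le (h : IsCascade μ ε δ F) (hα : 0 ≤ α) (hε : 0 < ε) (hε1 : ε ≤ 1)
    (hδ : ∀ k, 0 ≤ δ k) (k : ℕ) (x : E) :
    ‖(ε ^ (-α)) ^ k • (F k).bumps α ε x‖ ≤ ε ^ (-α) * ((ε ^ (-α)) ^ k * δ k) := by
  have h0 : 0 ≤ ε ^ (-α) := Real.rpow_nonneg hε.le _
  rw [norm_smul, Real.norm_of_nonneg (pow_nonneg h0 k), mul_left_comm]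
  exact mul_le_mul_of_nonneg_left (BallFamily.norm_bumps_le hα hε hε1 (hδ k) (h.radius_le k) x)
    (pow_nonneg h0 k)

/-- Weierstrass test: generation `k` is uniformly of size at most a constant times `λ ^ k δ k`, with
`λ = ε ^ (-α)`. -/
lemma continuous_cascadeMap [CompleteSpace E] (h : IsCascade μ ε δ F) (hα : 0 ≤ α) (hε : 0 < ε) (hε1 : ε ≤ 1)
    (hδ : ∀ k, 0 ≤ δ k) (hsum : Summable fun k => (ε ^ (-α)) ^ k * δ k) :
    Continuous (cascadeMap α ε F) := by
  obtain ⟨C, hC⟩ := BallFamily.exists_lipschitzWith_bumps E hα hε hε1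
  exact continuous_id.add (continuous_tsum (fun k => (hC (F k)).continuous.const_smul _)
    (hsum.mul_left _) (h.norm_smul_bumps_le hα hε hε1 hδ))

lemma fderiv_bumps_of_lt (h : IsCascade μ ε δ F) (hε1 : ε ≤ 1) {m k : ℕ} (hmk : m < k) {x : E}
    (hx : x ∈ (F m).shell ε) : fderiv ℝ ((F k).bumps α ε) x = 0 :=
  BallFamily.fderiv_bumps_of_disjoint ((F m).isOpen_shell ε) (h.disjoint_shell_body hε1 hmk) hx

lemma hasSum_fderiv_bumps (h : IsCascade μ ε δ F) (hε1 : ε ≤ 1) {k : ℕ} {x : E}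
    (hx : x ∈ (F k).shell ε) :
    HasSum (fun m => (ε ^ (-α)) ^ m • fderiv ℝ ((F m).bumps α ε) x)
      (∑ m ∈ Finset.range (k + 1), (ε ^ (-α)) ^ m • fderiv ℝ ((F m).bumps α ε) x) :=
  hasSum_sum_of_ne_finset_zero fun m hm => by
    rw [h.fderiv_bumps_of_lt hε1 (by simpa using hm : k + 1 ≤ m) hx, smul_zero]

/-- A point of the `k`-th shell lies in all earlier cores and outside all later bodies. With `λ = ε
^ (-α)`, the earlier terms telescope, `1 + ∑_{m<k} λ ^ m (λ - 1) = λ ^ k`, and the resulting `λ ^ k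
I` cancels the `-I` in the derivative of the `k`-th bump. -/
lemma exists_cascadeDeriv_eq (h : IsCascade μ ε δ F) (hε : 0 < ε) (hε1 : ε ≤ 1) {k : ℕ} {x : E}
    (hx : x ∈ (F k).shell ε) :
    ∃ t ∈ Ioo ε 1, ∃ u : E, ‖u‖ = 1 ∧
      cascadeDeriv α ε F x = ((ε ^ (-α)) ^ k * t ^ (-α)) • radialDeriv α u := by
  obtain ⟨t, ht, u, hu, e⟩ := BallFamily.exists_fderiv_bumps_of_mem_shell (α := α) hε hx
  refine ⟨t, ht, u, hu, ?_⟩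
  have hlt : ∀ m ∈ Finset.range k, (ε ^ (-α)) ^ m • fderiv ℝ ((F m).bumps α ε) x =
      ((ε ^ (-α)) ^ m * (ε ^ (-α) - 1)) • ContinuousLinearMap.id ℝ E := fun m hm => by
    rw [BallFamily.fderiv_bumps_of_mem_core hε1 (h.body_subset_core hε1 (Finset.mem_range.1 hm)
      ((F k).shell_subset_body ε hx)), smul_smul]
  rw [cascadeDeriv, (h.hasSum_fderiv_bumps hε1 hx).tsum_eq, Finset.sum_range_succ,
    Finset.sum_congr rfl hlt, ← Finset.sum_smul, ← Finset.sum_mul, geom_sum_mul, e]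
  module

end IsCascade

end CascadeMap

/-! ### Integration by parts for Lipschitz maps -/

section IntegrationByParts

variable {E : Type*} [NormedAddCommGroup E] [InnerProductSpace ℝ E] [FiniteDimensional ℝ E]
  [MeasurableSpace E] [BorelSpace E] {μ : Measure E} [μ.IsAddHaarMeasure]

omit [FiniteDimensional ℝ E] in
lemma integrable_fderiv_smul {φ : E → ℝ} (hφ : ContDiff ℝ ∞ φ) (hc : HasCompactSupport φ)
    {u : E → E} (hu : Continuous u) (v : E) : Integrable (fun x => fderiv ℝ φ x v • u x) μ := by
  have hφ' : Continuous fun x => fderiv ℝ φ x v :=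
    (hφ.continuous_fderiv (by simp)).clm_apply continuous_const
  exact (hφ'.smul hu).integrable_of_hasCompactSupport (hc.fderiv_apply ℝ v).smul_right

lemma integrable_smul_fderiv {φ : E → ℝ} (hφ : Continuous φ) (hc : HasCompactSupport φ)
    {u : E → E} {C : ℝ≥0} (hu : LipschitzWith C u) (v : E) :
    Integrable (fun x => φ x • fderiv ℝ u x v) μ := by
  refine ((hφ.integrable_of_hasCompactSupport hc).norm.mul_const (C * ‖v‖)).mono'
    (hφ.aestronglyMeasurable.smul (measurable_fderiv_apply_const ℝ u v).aestronglyMeasurable) ?_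
  refine Eventually.of_forall fun x => ?_
  rw [norm_smul]
  exact mul_le_mul_of_nonneg_left (ContinuousLinearMap.le_of_opNorm_le _
    (norm_fderiv_le_of_lipschitz ℝ hu) v) (norm_nonneg _)

/-- Integration by parts of a vector valued Lipschitz map against a test function. -/
lemma LipschitzWith.integral_fderiv_smul {φ : E → ℝ} (hφ : ContDiff ℝ ∞ φ)
    (hc : HasCompactSupport φ) {u : E → E} {C : ℝ≥0} (hu : LipschitzWith C u) (v : E) :
    ∫ x, fderiv ℝ φ x v • u x ∂μ = -∫ x, φ x • fderiv ℝ u x v ∂μ := by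
  -- Pairing with a fixed vector `w` reduces the claim to scalar Lipschitz functions.
  refine ext_inner_left ℝ fun w => ?_
  obtain ⟨D, hD⟩ := hφ.lipschitzWith_of_hasCompactSupport hc (by simp)
  have hw : LipschitzWith (‖innerSL ℝ w‖₊ * C) fun x => innerSL ℝ w (u x) :=
    (innerSL ℝ w).lipschitz.comp hu
  have key := LipschitzWith.integral_lineDeriv_mul_eq (μ := μ) hw hD hc v
  rw [inner_neg_right, ← integral_inner (integrable_fderiv_smul hφ hc hu.continuous v),
    ← integral_inner (integrable_smul_fderiv hφ.continuous hc hu v)]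
  have e1 : ∫ x, lineDeriv ℝ φ x (-v) * innerSL ℝ w (u x) ∂μ =
      -∫ x, inner ℝ w (fderiv ℝ φ x v • u x) ∂μ := by
    rw [← integral_neg]
    refine integral_congr_ae (Eventually.of_forall fun x => ?_)
    simp only [((hφ.differentiable (by simp)) x).lineDeriv_eq_fderiv, map_neg,
      innerSL_apply_apply, inner_smul_right, neg_mul]
  have e2 : ∫ x, lineDeriv ℝ (fun x => innerSL ℝ w (u x)) x v * φ x ∂μ =
      ∫ x, inner ℝ w (φ x • fderiv ℝ u x v) ∂μ := by
    refine integral_congr_ae ?_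
    filter_upwards [hu.ae_differentiableAt (μ := μ)] with x hx
    have h1 : HasFDerivAt (fun x => innerSL ℝ w (u x)) ((innerSL ℝ w).comp (fderiv ℝ u x)) x :=
      (innerSL ℝ w).hasFDerivAt.comp x hx.hasFDerivAt
    rw [h1.differentiableAt.lineDeriv_eq_fderiv, h1.fderiv, inner_smul_right, mul_comm]
    simp
  rw [← e2, key, e1, neg_neg]

end IntegrationByParts

/-! ### Integrability of the gradient and its weak formulation -/

namespace IsCascade

variable {E : Type*} [NormedAddCommGroup E] [InnerProductSpace ℝ E] [FiniteDimensional ℝ E]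
  [Nontrivial E] [MeasurableSpace E] [BorelSpace E] {μ : Measure E} [μ.IsAddHaarMeasure]
  {α ε : ℝ} {δ : ℕ → ℝ} {F : ℕ → BallFamily E}

/-- Localises the `k`-th gradient to the `k`-th body, whose measure decays geometrically. Almost
every point outside that body lies in a shell of an earlier generation, an open set on which the
later bumps vanish. -/
lemma ae_fderiv_bumps_eq_zero (h : IsCascade μ ε δ F) (hε : 0 < ε) (hε1 : ε < 1)
    (hfin : μ (F 0).body ≠ ⊤) :
    ∀ᵐ x ∂μ, x ∈ (F 0).body → ∀ k, x ∉ (F k).body → fderiv ℝ ((F k).bumps α ε) x = 0 := by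
  filter_upwards [h.ae_mem_shell hε hε1 hfin] with x hx hx0 k hk
  obtain ⟨m, hm⟩ := hx hx0
  refine h.fderiv_bumps_of_lt hε1.le (not_le.1 fun hkm => hk ?_) hm
  rcases hkm.eq_or_lt with rfl | hlt
  · exact (F k).shell_subset_body ε hm
  · exact (F k).core_subset_body hε1.le (h.body_subset_core hε1.le hlt
      ((F m).shell_subset_body ε hm))

omit [FiniteDimensional ℝ E] [Nontrivial E] [BorelSpace E] [μ.IsAddHaarMeasure] in
lemma norm_cascadeDeriv_le (h : IsCascade μ ε δ F) (h0 : 0 ≤ α) (h2 : α ≤ 2) (hε : 0 < ε)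
    (hε1 : ε ≤ 1) {k : ℕ} {x : E} (hx : x ∈ (F k).shell ε) :
    ‖cascadeDeriv α ε F x‖ ≤ (ε ^ (-α)) ^ (k + 1) := by
  obtain ⟨t, ht, u, hu, e⟩ := h.exists_cascadeDeriv_eq (α := α) hε hε1 hx
  have ht0 : 0 < t := hε.trans ht.1
  have hc : (ε ^ (-α)) ^ k * t ^ (-α) ≤ (ε ^ (-α)) ^ (k + 1) :=
    mul_le_mul_of_nonneg_left (Real.rpow_le_rpow_of_nonpos hε ht.1.le (by linarith))
      (by positivity)
  refine ContinuousLinearMap.opNorm_le_bound _ (by positivity) fun ξ => ?_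
  rw [e, smul_apply, norm_smul, Real.norm_of_nonneg (by positivity)]
  exact mul_le_mul hc (norm_radialDeriv_apply_le h0 h2 hu ξ) (norm_nonneg _) (by positivity)

lemma aestronglyMeasurable_cascadeDeriv (h : IsCascade μ ε δ F) (hε : 0 < ε) (hε1 : ε < 1)
    (hfin : μ (F 0).body ≠ ⊤) :
    AEStronglyMeasurable (cascadeDeriv α ε F) (μ.restrict (F 0).body) := by
  refine aestronglyMeasurable_const.add (aestronglyMeasurable_of_tendsto_ae atTop
    (f := fun n x => ∑ m ∈ Finset.range n, (ε ^ (-α)) ^ m • fderiv ℝ ((F m).bumps α ε) x)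
    (fun n => ?_) ?_)
  · exact Finset.aestronglyMeasurable_fun_sum _ fun m _ =>
      (measurable_fderiv ℝ ((F m).bumps α ε)).aestronglyMeasurable.const_smul ((ε ^ (-α)) ^ m)
  · filter_upwards [ae_restrict_of_ae (h.ae_mem_shell hε hε1 hfin),
      ae_restrict_mem (F 0).measurableSet_body] with x hx hx0
    obtain ⟨k, hk⟩ := hx hx0
    have hS := h.hasSum_fderiv_bumps (α := α) hε1.le hk
    rw [hS.tsum_eq]
    exact hS.tendsto_sum_nat

/-- Generation `k` contributes at most a constant times the `k`-th power of the quantity in `hpε`,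
so a convergent geometric series bounds the integral. -/
lemma memLp_cascadeDeriv (h : IsCascade μ ε δ F) (h0 : 0 ≤ α) (h2 : α ≤ 2) (hε : 0 < ε)
    (hε1 : ε < 1) (hfin : μ (F 0).body ≠ ⊤) {p : ℝ} (hp : 0 < p)
    (hpε : (ε ^ (-α)) ^ p * ε ^ Module.finrank ℝ E < 1) :
    MemLp (cascadeDeriv α ε F) (ENNReal.ofReal p) (μ.restrict (F 0).body) := by
  have hl : 0 < ε ^ (-α) := Real.rpow_pos_of_pos hε _
  refine ⟨h.aestronglyMeasurable_cascadeDeriv hε hε1 hfin, ?_⟩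
  rw [eLpNorm_lt_top_iff_lintegral_rpow_enorm_lt_top (by simpa using hp) ENNReal.ofReal_ne_top,
    ENNReal.toReal_ofReal hp.le]
  have hcov : (F 0).body ≤ᵐ[μ] ⋃ k, (F k).shell ε := by
    filter_upwards [h.ae_mem_shell hε hε1 hfin] with x hx hx0
    exact mem_iUnion.2 (hx hx0)
  have hterm : ∀ k, ∫⁻ x in (F k).shell ε, ‖cascadeDeriv α ε F x‖ₑ ^ p ∂μ ≤
      ENNReal.ofReal ((ε ^ (-α)) ^ p) * μ (F 0).body *
        ENNReal.ofReal ((ε ^ (-α)) ^ p * ε ^ Module.finrank ℝ E) ^ k := fun k => by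
    have hb : ∀ x ∈ (F k).shell ε, ‖cascadeDeriv α ε F x‖ₑ ^ p ≤
        ENNReal.ofReal ((ε ^ (-α)) ^ p) ^ (k + 1) := fun x hx => by
      have := h.norm_cascadeDeriv_le h0 h2 hε hε1.le hx
      rw [← ofReal_norm, ENNReal.ofReal_rpow_of_nonneg (norm_nonneg _) hp.le,
        ← ENNReal.ofReal_pow (by positivity)]
      refine ENNReal.ofReal_le_ofReal ((Real.rpow_le_rpow (norm_nonneg _) this hp.le).trans_eq ?_)
      rw [← Real.rpow_natCast, ← Real.rpow_natCast, ← Real.rpow_mul hl.le, ← Real.rpow_mul hl.le,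
        mul_comm]
    calc _ ≤ ∫⁻ _ in (F k).shell ε, ENNReal.ofReal ((ε ^ (-α)) ^ p) ^ (k + 1) ∂μ :=
          setLIntegral_mono measurable_const hb
      _ ≤ ENNReal.ofReal ((ε ^ (-α)) ^ p) ^ (k + 1) * μ (F k).body := by
          rw [setLIntegral_const]
          exact mul_le_mul_right (measure_mono ((F k).shell_subset_body ε)) _
      _ = _ := by
          rw [h.measure_body hε hε1.le, ENNReal.ofReal_mul (by positivity), mul_pow, pow_succ]
          ring
  calc _ ≤ ∫⁻ x in ⋃ k, (F k).shell ε, ‖cascadeDeriv α ε F x‖ₑ ^ p ∂μ :=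
        lintegral_mono' (Measure.restrict_mono_ae hcov) le_rfl
    _ ≤ ∑' k, ∫⁻ x in (F k).shell ε, ‖cascadeDeriv α ε F x‖ₑ ^ p ∂μ := lintegral_iUnion_le _ _
    _ ≤ _ := ENNReal.tsum_le_tsum hterm
    _ < ⊤ := by
      rw [ENNReal.tsum_mul_left, ENNReal.tsum_geometric]
      refine ENNReal.mul_lt_top (ENNReal.mul_lt_top ENNReal.ofReal_lt_top hfin.lt_top)
        (ENNReal.inv_lt_top.2 (tsub_pos_of_lt ?_))
      rw [← ENNReal.ofReal_one]
      exact (ENNReal.ofReal_lt_ofReal_iff one_pos).2 hpε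

/-- Since `ε ^ (-α) * ε ≥ 1`, the growth of the gradient compensates the loss of measure, and every
generation contributes at least the same `c > 0`. Generation 0 is skipped because only the later
shells lie in the core of the first family. -/
lemma lintegral_cascadeDeriv_eq_top (h : IsCascade μ ε δ F) (h0 : 0 ≤ α) (h2 : α ≤ 2) (h1 : 1 < α)
    (hε : 0 < ε) (hε1 : ε < 1) (hfin : μ (F 0).body ≠ ⊤) (hpos : μ (F 0).body ≠ 0) :
    ∫⁻ x in (F 0).core ε, ‖cascadeDeriv α ε F x‖ₑ ^ (Module.finrank ℝ E : ℝ) ∂μ = ⊤ := by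
  set d := Module.finrank ℝ E with hd
  set c : ℝ≥0∞ := ENNReal.ofReal ((α - 1) ^ d) *
    (ENNReal.ofReal (1 - ε ^ d) * μ (F 0).body) with hc
  have hd0 : d ≠ 0 := Module.finrank_pos.ne'
  have hl : 1 ≤ ε ^ (-α) * ε := by
    rw [← Real.rpow_add_one hε.ne']
    exact Real.one_le_rpow_of_pos_of_le_one_of_nonpos hε hε1.le (by linarith)
  have hc0 : c ≠ 0 := by
    have h3 : ε ^ d < 1 := pow_lt_one₀ hε.le hε1 hd0
    have h4 : 0 < (α - 1) ^ d := pow_pos (by linarith) _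
    simp [hc, h3, h4, hpos]
  have hlow : ∀ k, c ≤ ∫⁻ x in (F (k + 1)).shell ε, ‖cascadeDeriv α ε F x‖ₑ ^ (d : ℝ) ∂μ :=
    fun k => by
    have hb : ∀ x ∈ (F (k + 1)).shell ε, ENNReal.ofReal (((ε ^ (-α)) ^ (k + 1) * (α - 1)) ^ d) ≤
        ‖cascadeDeriv α ε F x‖ₑ ^ (d : ℝ) := fun x hx => by
      obtain ⟨t, ht, u, hu, e⟩ := h.exists_cascadeDeriv_eq (α := α) hε hε1.le hx
      have ht1 : 1 ≤ t ^ (-α) := Real.one_le_rpow_of_pos_of_le_one_of_nonpos (hε.trans ht.1)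
        ht.2.le (by linarith)
      rw [ENNReal.rpow_natCast, ← ofReal_norm, ← ENNReal.ofReal_pow (norm_nonneg _)]
      refine ENNReal.ofReal_le_ofReal (pow_le_pow_left₀
        (mul_nonneg (by positivity) (by linarith)) ?_ d)
      have hu1 := (cascadeDeriv α ε F x).le_opNorm u
      have hu2 := le_norm_radialDeriv_apply h0 h2 hu u
      rw [hu, mul_one, e, smul_apply, norm_smul, Real.norm_of_nonneg (by positivity), ← e] at hu1
      rw [hu, mul_one, abs_sub_comm, abs_of_pos (by linarith)] at hu2
      refine le_trans (mul_le_mul ?_ hu2 (by linarith) (by positivity)) hu1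
      exact le_mul_of_one_le_right (by positivity) ht1
    calc c ≤ ENNReal.ofReal (((ε ^ (-α)) ^ (k + 1) * (α - 1)) ^ d) *
          (ENNReal.ofReal (1 - ε ^ d) * (ENNReal.ofReal (ε ^ d) ^ (k + 1) * μ (F 0).body)) := by
          have e1 : ENNReal.ofReal (((ε ^ (-α)) ^ (k + 1) * (α - 1)) ^ d) *
              ENNReal.ofReal (ε ^ d) ^ (k + 1) =
              ENNReal.ofReal (((ε ^ (-α) * ε) ^ (k + 1)) ^ d * (α - 1) ^ d) := by
            have : 0 ≤ ((ε ^ (-α)) ^ (k + 1) * (α - 1)) ^ d :=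
              pow_nonneg (mul_nonneg (by positivity) (by linarith)) d
            rw [← ENNReal.ofReal_pow (by positivity), ← ENNReal.ofReal_mul this]
            congr 1
            simp only [mul_pow]
            ring
          have e2 : ENNReal.ofReal ((α - 1) ^ d) ≤
              ENNReal.ofReal (((ε ^ (-α) * ε) ^ (k + 1)) ^ d * (α - 1) ^ d) :=
            ENNReal.ofReal_le_ofReal (le_mul_of_one_le_left (pow_nonneg (by linarith) d)
              (one_le_pow₀ (one_le_pow₀ hl)))
          rw [← e1] at e2
          exact (mul_le_mul_left e2 _).trans_eq (by ring)
      _ ≤ ∫⁻ _ in (F (k + 1)).shell ε,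
          ENNReal.ofReal (((ε ^ (-α)) ^ (k + 1) * (α - 1)) ^ d) ∂μ := by
          rw [setLIntegral_const]
          exact mul_le_mul_right (h.measure_shell_ge hε hε1.le hfin (k + 1)) _
      _ ≤ _ := setLIntegral_mono' ((F (k + 1)).isOpen_shell ε).measurableSet hb
  have hsub : (⋃ k, (F (k + 1)).shell ε) ⊆ (F 0).core ε := iUnion_subset fun k =>
    ((F (k + 1)).shell_subset_body ε).trans (h.body_subset_core hε1.le k.succ_pos)
  refine top_unique (le_trans ?_ (lintegral_mono_set hsub))
  rw [lintegral_iUnion (fun k => ((F (k + 1)).isOpen_shell ε).measurableSet) fun i j hij =>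
    h.pairwise_disjoint_shell hε1.le (by simpa using hij)]
  rw [← ENNReal.tsum_const_eq_top_of_ne_zero (α := ℕ) hc0]
  exact ENNReal.tsum_le_tsum hlow

/-- Each generation is Lipschitz and can be integrated by parts. Both resulting series converge
absolutely in `L^1`: the maps by `hsum`, the gradients by `hαε`. -/
lemma integral_fderiv_smul_cascadeMap (h : IsCascade μ ε δ F) (hα : 0 ≤ α) (hα2 : α ≤ 2)
    (hε : 0 < ε) (hε1 : ε < 1) (hδ : ∀ k, 0 ≤ δ k) (hsum : Summable fun k => (ε ^ (-α)) ^ k * δ k)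
    (hfin : μ (F 0).body ≠ ⊤) (hαε : ε ^ (-α) * ε ^ Module.finrank ℝ E < 1)
    {φ : E → ℝ} (hφ : ContDiff ℝ ∞ φ) (hc : HasCompactSupport φ)
    (hφF : ∀ x ∉ (F 0).body, φ x = 0) (v : E) :
    ∫ x, fderiv ℝ φ x v • cascadeMap α ε F x ∂μ = -∫ x, φ x • cascadeDeriv α ε F x v ∂μ := by
  obtain ⟨C, hC⟩ := BallFamily.exists_lipschitzWith_bumps E hα hε hε1.le
  have h0 : 0 < ε ^ (-α) := Real.rpow_pos_of_pos hε _
  have hi1 : ∀ k, Integrable (fun x => fderiv ℝ φ x v • (ε ^ (-α)) ^ k • (F k).bumps α ε x) μ :=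
    fun k => integrable_fderiv_smul hφ hc ((hC (F k)).continuous.const_smul _) v
  have hi2 : ∀ k,
      Integrable (fun x => φ x • (ε ^ (-α)) ^ k • fderiv ℝ ((F k).bumps α ε) x v) μ := fun k => by
    simp only [smul_comm (_ : ℝ) ((ε ^ (-α)) ^ k)]
    exact (integrable_smul_fderiv hφ.continuous hc (hC (F k)) v).smul _
  have hparts : ∀ k, ∫ x, fderiv ℝ φ x v • (ε ^ (-α)) ^ k • (F k).bumps α ε x ∂μ =
      -∫ x, φ x • (ε ^ (-α)) ^ k • fderiv ℝ ((F k).bumps α ε) x v ∂μ := fun k => by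
    simp only [smul_comm (_ : ℝ) ((ε ^ (-α)) ^ k)]
    rw [integral_smul, integral_smul, (hC (F k)).integral_fderiv_smul hφ hc v, smul_neg]
  have hs1 : Summable fun k =>
      ∫ x, ‖fderiv ℝ φ x v • (ε ^ (-α)) ^ k • (F k).bumps α ε x‖ ∂μ := by
    have hφ' : Integrable (fun x => fderiv ℝ φ x v) μ :=
      ((hφ.continuous_fderiv (by simp)).clm_apply continuous_const).integrable_of_hasCompactSupport
        (hc.fderiv_apply ℝ v)
    refine Summable.of_nonneg_of_le (fun k => integral_nonneg fun x => norm_nonneg _) (fun k => ?_)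
      ((hsum.mul_left (ε ^ (-α))).mul_left (∫ x, ‖fderiv ℝ φ x v‖ ∂μ))
    rw [← integral_mul_const]
    refine integral_mono (hi1 k).norm (hφ'.norm.mul_const _) fun x => ?_
    simp only [norm_smul (fderiv ℝ φ x v)]
    exact mul_le_mul_of_nonneg_left (h.norm_smul_bumps_le hα hε hε1.le hδ k x) (norm_nonneg _)
  have hs2 : Summable fun k =>
      ∫ x, ‖φ x • (ε ^ (-α)) ^ k • fderiv ℝ ((F k).bumps α ε) x v‖ ∂μ := by
    obtain ⟨M, hM⟩ := hφ.continuous.bounded_above_of_compact_support hc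
    have hM0 : 0 ≤ M := (norm_nonneg _).trans (hM 0)
    refine Summable.of_nonneg_of_le (fun k => integral_nonneg fun x => norm_nonneg _) (fun k => ?_)
      ((summable_geometric_of_lt_one (by positivity) hαε).mul_left
        (μ.real (F 0).body * (M * (C * ‖v‖))))
    -- Inside the `k`-th body the uniform Lipschitz constant bounds the derivative; elsewhere in the
    -- first body the derivative vanishes almost everywhere, and outside the first body `φ`
    -- vanishes.
    have hb : ∀ᵐ x ∂μ, ‖φ x • (ε ^ (-α)) ^ k • fderiv ℝ ((F k).bumps α ε) x v‖ ≤
        (F k).body.indicator (fun _ => (ε ^ (-α)) ^ k * (M * (C * ‖v‖))) x := by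
      filter_upwards [h.ae_fderiv_bumps_eq_zero (α := α) hε hε1 hfin] with x hx
      by_cases hxk : x ∈ (F k).body
      · rw [indicator_of_mem hxk, norm_smul, norm_smul, Real.norm_of_nonneg (pow_nonneg h0.le k),
          mul_left_comm]
        refine mul_le_mul_of_nonneg_left (mul_le_mul (hM x) ?_ (norm_nonneg _) hM0)
          (pow_nonneg h0.le k)
        exact ContinuousLinearMap.le_of_opNorm_le _ (norm_fderiv_le_of_lipschitz ℝ (hC (F k))) v
      · rw [indicator_of_notMem hxk]
        by_cases hx0 : x ∈ (F 0).body
        · simp [hx hx0 k hxk]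
        · simp [hφF x hx0]
    have hk : μ (F k).body ≠ ⊤ := by
      rw [h.measure_body hε hε1.le k]
      exact ENNReal.mul_ne_top (ENNReal.pow_ne_top ENNReal.ofReal_ne_top) hfin
    have hint : Integrable ((F k).body.indicator fun _ => (ε ^ (-α)) ^ k * (M * (C * ‖v‖))) μ :=
      (integrable_indicator_iff (F k).measurableSet_body).2 (integrableOn_const hk)
    refine (integral_mono_ae (hi2 k).norm hint hb).trans_eq ?_
    rw [integral_indicator (F k).measurableSet_body, setIntegral_const, measureReal_def,
      h.measure_body hε hε1.le k, ENNReal.toReal_mul, ENNReal.toReal_pow,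
      ENNReal.toReal_ofReal (by positivity), measureReal_def, smul_eq_mul, mul_pow]
    ring
  have H1 := hasSum_integral_of_summable_integral_norm hi1 hs1
  have H2 := hasSum_integral_of_summable_integral_norm hi2 hs2
  have hsumE : (∫ x, ∑' k, fderiv ℝ φ x v • (ε ^ (-α)) ^ k • (F k).bumps α ε x ∂μ) =
      -∫ x, ∑' k, φ x • (ε ^ (-α)) ^ k • fderiv ℝ ((F k).bumps α ε) x v ∂μ := by
    rw [← H1.tsum_eq, ← H2.tsum_eq, ← tsum_neg]
    exact tsum_congr hparts
  have hid := (LipschitzWith.id (α := E)).integral_fderiv_smul (μ := μ) hφ hc v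
  have l1 : ∀ x, fderiv ℝ φ x v • cascadeMap α ε F x = fderiv ℝ φ x v • id x +
      ∑' k, fderiv ℝ φ x v • (ε ^ (-α)) ^ k • (F k).bumps α ε x := fun x => by
    rw [cascadeMap, smul_add, id, Summable.tsum_const_smul]
    exact .of_norm_bounded (hsum.mul_left _) fun k => h.norm_smul_bumps_le hα hε hε1.le hδ k x
  have l2 : ∀ᵐ x ∂μ, φ x • cascadeDeriv α ε F x v = φ x • fderiv ℝ (id : E → E) x v +
      ∑' k, φ x • (ε ^ (-α)) ^ k • fderiv ℝ ((F k).bumps α ε) x v := by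
    filter_upwards [h.ae_mem_shell hε hε1 hfin] with x hx
    by_cases hx0 : x ∈ (F 0).body
    · obtain ⟨k, hk⟩ := hx hx0
      have hS := h.hasSum_fderiv_bumps (α := α) hε1.le hk
      have hv := (hS.mapL (ContinuousLinearMap.apply ℝ E v)).const_smul (φ x)
      simp only [ContinuousLinearMap.apply_apply, smul_apply] at hv
      rw [hv.tsum_eq, cascadeDeriv, hS.tsum_eq, fderiv_id, add_apply, smul_add]
    · simp [hφF x hx0]
  have I1 : Integrable (fun x => ∑' k, fderiv ℝ φ x v • (ε ^ (-α)) ^ k • (F k).bumps α ε x) μ := by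
    have := (integrable_fderiv_smul (μ := μ) hφ hc
      (h.continuous_cascadeMap hα hε hε1.le hδ hsum) v).sub
      (integrable_fderiv_smul (μ := μ) hφ hc continuous_id v)
    refine this.congr (Eventually.of_forall fun x => ?_)
    simp only [Pi.sub_apply, l1, add_sub_cancel_left]
  have I2 : Integrable
      (fun x => ∑' k, φ x • (ε ^ (-α)) ^ k • fderiv ℝ ((F k).bumps α ε) x v) μ := by
    have hG : IntegrableOn (cascadeDeriv α ε F) (F 0).body μ := by
      have := h.memLp_cascadeDeriv hα hα2 hε hε1 hfin one_pos (by rwa [Real.rpow_one])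
      rwa [ENNReal.ofReal_one, memLp_one_iff_integrable] at this
    obtain ⟨M, hM⟩ := hφ.continuous.bounded_above_of_compact_support hc
    have hφG : Integrable (fun x => φ x • cascadeDeriv α ε F x v) μ := by
      refine IntegrableOn.integrable_of_forall_notMem_eq_zero (s := (F 0).body) ?_
        fun x hx => by rw [hφF x hx, zero_smul]
      exact (hG.apply_continuousLinearMap v).bdd_smul M hφ.continuous.aestronglyMeasurable
        (Eventually.of_forall hM)
    refine (hφG.sub (integrable_smul_fderiv hφ.continuous hc LipschitzWith.id v)).congr ?_
    filter_upwards [l2] with x hx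
    rw [Pi.sub_apply, hx, add_sub_cancel_left]
  rw [integral_congr_ae (Eventually.of_forall l1), integral_congr_ae l2,
    integral_add (integrable_fderiv_smul hφ hc continuous_id v) I1,
    integral_add (integrable_smul_fderiv hφ.continuous hc LipschitzWith.id v) I2, hid, hsumE,
    neg_add]

end IsCascade

/-! ### Uniqueness of the weak gradient -/

section WeakGradient

variable {n : ℕ} {Ω : Set (EuclideanSpace ℝ (Fin n))}
  {f : EuclideanSpace ℝ (Fin n) → EuclideanSpace ℝ (Fin n)}
  {G G' : EuclideanSpace ℝ (Fin n) → EuclideanSpace ℝ (Fin n) →L[ℝ] EuclideanSpace ℝ (Fin n)}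

lemma setIntegral_eq_integral_of_tsupport_subset {E : Type*} [NormedAddCommGroup E]
    [NormedSpace ℝ E] {φ : EuclideanSpace ℝ (Fin n) → ℝ} (hφ : tsupport φ ⊆ Ω)
    (g : EuclideanSpace ℝ (Fin n) → E) : ∫ x in Ω, φ x • g x = ∫ x, φ x • g x :=
  setIntegral_eq_integral_of_forall_compl_eq_zero fun x hx => by
    rw [image_eq_zero_of_notMem_tsupport fun h => hx (hφ h), zero_smul]

/-- The weak gradient is unique almost everywhere. -/
lemma HasWeakGradient.ae_eq (hΩ : IsOpen Ω) (hG : HasWeakGradient Ω f G)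
    (hG' : HasWeakGradient Ω f G') : ∀ᵐ x ∂volume.restrict Ω, G x = G' x := by
  obtain ⟨-, hGi, hG⟩ := hG
  obtain ⟨-, hGi', hG'⟩ := hG'
  have hsub : LocallyIntegrableOn (fun x => G x - G' x) Ω volume := hGi.sub hGi'
  have happ : ∀ {H : EuclideanSpace ℝ (Fin n) →
      EuclideanSpace ℝ (Fin n) →L[ℝ] EuclideanSpace ℝ (Fin n)},
      LocallyIntegrableOn H Ω volume → ∀ v, LocallyIntegrableOn (fun x => H x v) Ω volume :=
    fun hH v x hx => by
      obtain ⟨s, hs, hHs⟩ := hH x hx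
      exact ⟨s, hs, hHs.apply_continuousLinearMap v⟩
  have hint : ∀ {H : EuclideanSpace ℝ (Fin n) →
      EuclideanSpace ℝ (Fin n) →L[ℝ] EuclideanSpace ℝ (Fin n)},
      LocallyIntegrableOn H Ω volume → ∀ v (φ : EuclideanSpace ℝ (Fin n) → ℝ), Continuous φ →
      HasCompactSupport φ → tsupport φ ⊆ Ω → Integrable (fun x => φ x • H x v) volume :=
    fun hH v φ hφ hc hs => by
      have h1 := ((happ hH v).integrableOn_compact_subset hs hc).continuousOn_smul
        hφ.continuousOn hc
      exact h1.integrable_of_forall_notMem_eq_zero fun x hx => by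
        rw [image_eq_zero_of_notMem_tsupport hx, zero_smul]
  have hv : ∀ v, ∀ᵐ x ∂volume, x ∈ Ω → (G x - G' x) v = 0 := fun v => by
    refine hΩ.ae_eq_zero_of_integral_contDiff_smul_eq_zero (happ hsub v) fun φ hφ hc hs => ?_
    have h1 := hG φ hφ hc hs v
    rw [hG' φ hφ hc hs v, neg_inj, setIntegral_eq_integral_of_tsupport_subset hs,
      setIntegral_eq_integral_of_tsupport_subset hs] at h1
    simp only [sub_apply, smul_sub]
    rw [integral_sub (hint hGi v φ hφ.continuous hc hs) (hint hGi' v φ hφ.continuous hc hs), h1,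
      sub_self]
  rw [ae_restrict_iff' hΩ.measurableSet]
  -- The exceptional null set depends on the direction, so only the finitely many basis directions
  -- are used.
  have hb : ∀ᵐ x ∂volume, ∀ i, x ∈ Ω →
      (G x - G' x) (EuclideanSpace.basisFun (Fin n) ℝ i) = 0 :=
    ae_all_iff.2 fun i => hv _
  filter_upwards [hb] with x hx hxΩ
  refine sub_eq_zero.1 (ContinuousLinearMap.coe_injective
    ((EuclideanSpace.basisFun (Fin n) ℝ).toBasis.ext fun i => ?_))
  simpa using hx i hxΩ

end WeakGradient

section Euclidean

variable {n : ℕ} [Nontrivial (EuclideanSpace ℝ (Fin n))] {Ω : Set (EuclideanSpace ℝ (Fin n))}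
  {α ε : ℝ} {δ : ℕ → ℝ} {F : ℕ → BallFamily (EuclideanSpace ℝ (Fin n))}

namespace IsCascade

lemma hasWeakGradient_cascadeMap (h : IsCascade volume ε δ F) (hα : 0 ≤ α) (hα2 : α ≤ 2)
    (hε : 0 < ε) (hε1 : ε < 1) (hδ : ∀ k, 0 ≤ δ k)
    (hsum : Summable fun k => (ε ^ (-α)) ^ k * δ k) (hfin : volume (F 0).body ≠ ⊤)
    (hαε : ε ^ (-α) * ε ^ n < 1) (hΩF : Ω ⊆ (F 0).body) :
    HasWeakGradient Ω (cascadeMap α ε F) (cascadeDeriv α ε F) := by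
  have hαε' : ε ^ (-α) * ε ^ Module.finrank ℝ (EuclideanSpace ℝ (Fin n)) < 1 := by
    rwa [finrank_euclideanSpace_fin]
  refine ⟨(h.continuous_cascadeMap hα hε hε1.le hδ hsum).locallyIntegrable.locallyIntegrableOn _,
    ?_, fun φ hφ hc hs v => ?_⟩
  · have hG := h.memLp_cascadeDeriv hα hα2 hε hε1 hfin one_pos (by rwa [Real.rpow_one])
    rw [ENNReal.ofReal_one, memLp_one_iff_integrable] at hG
    exact (IntegrableOn.mono_set hG hΩF).locallyIntegrableOn
  · have hs' : tsupport (fun x => fderiv ℝ φ x v) ⊆ Ω := (tsupport_fderiv_apply_subset ℝ v).trans hs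
    rw [setIntegral_eq_integral_of_tsupport_subset hs',
      setIntegral_eq_integral_of_tsupport_subset hs]
    exact h.integral_fderiv_smul_cascadeMap hα hα2 hε hε1 hδ hsum hfin hαε' hφ hc
      (fun x hx => image_eq_zero_of_notMem_tsupport fun hx' => hx (hΩF (hs hx'))) v

end IsCascade

end Euclidean

/-! ### Choice of parameters and conclusion -/

/-- The exponents of the construction: a cascade with shrinking factor `ε` and stretching exponent
`1 + 1 / K` has a gradient in `L^p` as soon as `p < n K / (K + 1)`. -/
lemma rpow_rpow_mul_pow_lt_one {n : ℕ} {K p ε : ℝ} (hK : 1 ≤ K) (hε : 0 < ε) (hε1 : ε < 1)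
    (hp : p < n * K / (K + 1)) : (ε ^ (-(1 + 1 / K))) ^ p * ε ^ n < 1 := by
  have hK0 : 0 < K := by linarith
  rw [← Real.rpow_natCast, ← Real.rpow_mul hε.le, ← Real.rpow_add hε]
  refine Real.rpow_lt_one hε.le hε1 ?_
  rw [lt_div_iff₀ (by linarith)] at hp
  have e : -(1 + 1 / K) * p + n = (n * K - p * (K + 1)) / K := by
    field_simp
    ring
  rw [e]
  exact div_pos (by linarith) hK0

theorem theorem1p1 (n : ℕ) (hn : 3 ≤ n) (K : ℝ) (hK : 1 ≤ K)
    (Ω : Set (EuclideanSpace ℝ (Fin n))) (hΩo : IsOpen Ω) (hΩc : IsConnected Ω)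
    (hΩb : Bornology.IsBounded Ω)
    (p : ℝ) (hp1 : 1 < p) (hp2 : p < n * K / (K + 1)) :
    ∃ f : EuclideanSpace ℝ (Fin n) → EuclideanSpace ℝ (Fin n),
      IsWeaklyQuasiregularMap (ENNReal.ofReal p) K Ω f ∧
      MemW1p (ENNReal.ofReal p) Ω f ∧
      ContinuousOn f Ω ∧
      MemLp f ∞ (volume.restrict Ω) ∧
      ¬ ∃ K' : ℝ, IsQuasiregularMap K' Ω f := by
  have : NeZero n := ⟨by omega⟩
  have : Nontrivial (EuclideanSpace ℝ (Fin n)) :=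
    Module.nontrivial_of_finrank_pos (R := ℝ) (by rw [finrank_euclideanSpace_fin]; omega)
  obtain ⟨a, ha⟩ := hΩc.nonempty
  obtain ⟨s, hs, hsΩ⟩ := nhds_basis_closedBall.mem_iff.1 (hΩo.mem_nhds ha)
  obtain ⟨R', hR'⟩ := hΩb.subset_closedBall a
  obtain ⟨R, hR'R, hsR⟩ : ∃ R, R' ≤ R ∧ s < R :=
    ⟨max R' (s + 1), le_max_left _ _, (lt_add_one s).trans_le (le_max_right _ _)⟩
  have hR : 0 < R := hs.trans hsR
  have hK0 : 0 < K := by linarith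
  set α : ℝ := 1 + 1 / K with hα
  have hα1 : 1 < α := by rw [hα]; linarith [one_div_pos.2 hK0]
  have hα2 : α ≤ 2 := by rw [hα]; linarith [(div_le_one hK0).2 hK]
  have hα0 : 0 ≤ α := by linarith
  -- With this ratio the core of the initial ball of radius `R`, which contains `Ω`, is the ball of
  -- radius `s`, whose closure is a compact subset of `Ω`. The divergence of the `L^n` integral
  -- there contradicts local integrability.
  set ε : ℝ := s / R
  have hε : 0 < ε := div_pos hs hR
  have hε1 : ε < 1 := (div_lt_one hR).2 hsR
  have hl : 0 < ε ^ (-α) := Real.rpow_pos_of_pos hε _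
  -- Chosen so that `(ε ^ (-α)) ^ k * δ k = R / 2 ^ k`, while `δ 0 = R` admits the initial ball.
  set δ : ℕ → ℝ := fun k => R * (2 * ε ^ (-α))⁻¹ ^ k with hδ
  have hδ0 : ∀ k, 0 < δ k := fun k => by positivity
  have hsum : Summable fun k => (ε ^ (-α)) ^ k * δ k := by
    refine (summable_geometric_two.mul_left R).congr fun k => ?_
    rw [hδ, mul_left_comm, ← mul_pow]
    congr 2
    field_simp
  obtain ⟨F, h, hF0⟩ := exists_isCascade (volume : Measure (EuclideanSpace ℝ (Fin n))) ε hδ0 a hR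
    (by simp [hδ])
  have hbody : (F 0).body = closedBall a R := by rw [hF0, BallFamily.body_single]
  have hcore : (F 0).core ε = ball a s := by
    rw [hF0, BallFamily.core_single, div_mul_cancel₀ s hR.ne']
  have hΩF : Ω ⊆ (F 0).body := hbody ▸ hR'.trans (closedBall_subset_closedBall hR'R)
  have hfin : volume (F 0).body ≠ ⊤ := hbody ▸ measure_closedBall_lt_top.ne
  have hpos : volume (F 0).body ≠ 0 := hbody ▸ (measure_closedBall_pos _ _ hR).ne'
  have hpε := rpow_rpow_mul_pow_lt_one hK hε hε1 hp2
  have hαε : ε ^ (-α) * ε ^ n < 1 := by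
    have h1 : (ε ^ (-α)) ^ (1 : ℝ) * ε ^ n < 1 :=
      rpow_rpow_mul_pow_lt_one hK hε hε1 (hp1.trans hp2)
    rwa [Real.rpow_one] at h1
  have hG := h.hasWeakGradient_cascadeMap hα0 hα2 hε hε1 (fun k => (hδ0 k).le) hsum hfin hαε hΩF
  have hcont := h.continuous_cascadeMap hα0 hε hε1.le (fun k => (hδ0 k).le) hsum
  have hGp : MemLp (cascadeDeriv α ε F) (ENNReal.ofReal p) (volume.restrict Ω) :=
    (h.memLp_cascadeDeriv hα0 hα2 hε hε1 hfin (by linarith)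
      (by rwa [finrank_euclideanSpace_fin])).mono_measure (Measure.restrict_mono_set _ hΩF)
  have : IsFiniteMeasure (volume.restrict Ω) :=
    isFiniteMeasure_restrict.2 ((measure_mono hΩF).trans_lt hfin.lt_top).ne
  have hftop : MemLp (cascadeMap α ε F) ∞ (volume.restrict Ω) := by
    obtain ⟨B, hB⟩ := (isCompact_closedBall a R).exists_bound_of_continuousOn hcont.continuousOn
    refine memLp_top_of_bound hcont.aestronglyMeasurable B ?_
    filter_upwards [ae_restrict_mem hΩo.measurableSet] with x hx
    exact hB x (hbody ▸ hΩF hx)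
  have hfp : MemLp (cascadeMap α ε F) (ENNReal.ofReal p) (volume.restrict Ω) :=
    hftop.mono_exponent le_top
  have hshell : ∀ᵐ x ∂volume.restrict Ω, ∃ c : ℝ, 0 < c ∧ ∃ u, ‖u‖ = 1 ∧
      cascadeDeriv α ε F x = c • radialDeriv α u := by
    filter_upwards [ae_restrict_of_ae (h.ae_mem_shell hε hε1 hfin),
      ae_restrict_mem hΩo.measurableSet] with x hx hxΩ
    obtain ⟨k, hk⟩ := hx (hΩF hxΩ)
    obtain ⟨t, ht, u, hu, e⟩ := h.exists_cascadeDeriv_eq (α := α) hε hε1.le hk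
    exact ⟨_, mul_pos (pow_pos hl k) (Real.rpow_pos_of_pos (hε.trans ht.1) _), u, hu, e⟩
  refine ⟨cascadeMap α ε F, ⟨cascadeDeriv α ε F, hG, fun C _ hC =>
    ⟨hfp.mono_measure (Measure.restrict_mono_set _ hC),
      hGp.mono_measure (Measure.restrict_mono_set _ hC)⟩, Or.inr ?_, ?_⟩,
    ⟨cascadeDeriv α ε F, hG, hfp, hGp⟩, hcont.continuousOn, hftop, ?_⟩
  · filter_upwards [hshell] with x ⟨c, hc, u, hu, e⟩
    have hdet := det_radialDeriv (α := α) hu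
    rw [ContinuousLinearMap.det] at hdet
    rw [e, ContinuousLinearMap.det, ContinuousLinearMap.toLinearMap_smul, LinearMap.det_smul, hdet]
    exact mul_nonpos_of_nonneg_of_nonpos (by positivity) (by linarith)
  · filter_upwards [hshell] with x ⟨c, hc, u, hu, e⟩ ξ hξ η hη
    rw [mem_sphere_zero_iff_norm] at hξ hη
    have h1 := norm_radialDeriv_apply_le hα0 hα2 hu ξ
    have h2 := le_norm_radialDeriv_apply hα0 hα2 hu η
    have h3 : |1 - α| = 1 / K := by
      rw [hα, sub_add_cancel_left, abs_neg, abs_of_pos (one_div_pos.2 hK0)]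
    rw [hξ] at h1
    rw [hη, mul_one, h3, div_le_iff₀' hK0] at h2
    rw [e, smul_apply, smul_apply, norm_smul, norm_smul, mul_left_comm]
    exact mul_le_mul_of_nonneg_left (h1.trans h2) (norm_nonneg c)
  -- Only membership in `W^{1,n}_loc` is refuted, so the value of `K'` is irrelevant.
  · rintro ⟨K', G', hG', hloc, -⟩
    have hn0 : (n : ℝ≥0∞) ≠ 0 := by simpa using (NeZero.ne n)
    have hlp := (hloc _ (isCompact_closedBall a s) hsΩ).2
    have hlt := (eLpNorm_lt_top_iff_lintegral_rpow_enorm_lt_top hn0 (by simp)).1 hlp.2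
    have htop := h.lintegral_cascadeDeriv_eq_top hα0 hα2 hα1 hε hε1 hfin hpos
    rw [hcore, finrank_euclideanSpace_fin] at htop
    have heq : ∫⁻ x in ball a s, ‖cascadeDeriv α ε F x‖ₑ ^ (n : ℝ) =
        ∫⁻ x in ball a s, ‖G' x‖ₑ ^ (n : ℝ) := by
      refine lintegral_congr_ae ?_
      filter_upwards [ae_restrict_of_ae_restrict_of_subset (ball_subset_closedBall.trans hsΩ)
        (hG.ae_eq hΩo hG')] with x hx
      rw [hx]
    rw [ENNReal.toReal_natCast] at hlt
    refine hlt.not_ge (htop.symm.le.trans ?_)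
    rw [heq]
    exact lintegral_mono_set ball_subset_closedBall
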